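/- **Theorem.** Let $(x,y,z,\bar x)$ be coordinates on $\mathbb{R}^4$, let $\varphi\in C^\infty(\mathbb{R})$ satisfy $\varphi''(y)\neq 0$ for all $y\in\mathbb{R}$, and let $\mathcal{M}_\varphi=(\mathbb{R}^4,g_\varphi)$, where $g_\varphi$ is the pseudo-Riemannian metric whose non-zero components are, up to symmetry, $$g_\varphi(\partial_x,\partial_{\bar x})=g_\varphi(\partial_y,\partial_y)=g_\varphi(\partial_z,\partial_z)=1,\qquad g_\varphi(\partial_x,\partial_z)=2\varphi(y).$$ Let $\nabla$ be the Levi-Civita connection, $\mathcal{R}(u,v)=\nabla_u\nabla_v-\nabla_v\nabla_u-\nabla_{[u,v]}$ the curvature operator, $R(u,v,w,s)=g_\varphi(\mathcal{R}(u,v)w,s)$ the curvature tensor, $\mathcal{J}(u)\colon \xi\mapsto\mathcal{R}(\xi,u)u$ the Jacobi operator, and $\rho$ the Ricci operator, i.e. $g_\varphi(\rho u,v)=\operatorname{Tr}\{\xi\mapsto\tfrac12(\mathcal{R}(\xi,u)v+\mathcal{R}(\xi,v)u)\}$. Then: 1. At every point of $\mathbb{R}^4$, $\operatorname{rank}\rho=2$,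 $\operatorname{rank}\rho^2=1$ and $\rho^3=0$. 2. $\mathcal{M}_\varphi$ is not Jacobi--Videv, i.e. it is not true that $\mathcal{J}(u)\rho=\rho\mathcal{J}(u)$ for all tangent vectors $u$ at all points. 3. $\alpha_\varphi:=(\varphi')^2/(\varphi'')^2$ is a local isometry invariant: if $\psi\in C^\infty(\mathbb{R})$ also has nowhere vanishing second derivative, and $\Phi\colon U\to\mathbb{R}^4$ is a smooth map on an open set $U\subseteq\mathbb{R}^4$ with $\Phi^*g_\psi=g_\varphi$ on $U$, then $\alpha_\psi(y(\Phi(p)))=\alpha_\varphi(y(p))$ for all $p\in U$. 4. The following are equivalent: (a) $\mathcal{M}_\varphi$ is curvature homogeneous, i.e. for all points $P,Q$ there is a linear isometry $L\colon T_P\to T_Q$ with $L^*R_Q=R_P$; (b) there is $b>0$ such that $\mathcal{M}_\varphi$ is isometric to $\mathcal{M}_{\varphi_b}$, where $\varphi_b(y)=e^{by}$; (c) $\mathcal{M}_\varphi$ is homogeneous, i.e. its isometry group acts transitively on $\mathbb{R}^4$. -/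

import Mathlib

open scoped ContDiff Matrix

noncomputable section

namespace PseudoRiem

/-- A smooth pseudo-Riemannian metric on the manifold `ℝⁿ`, given by its components
`g p i j = g(∂ᵢ, ∂ⱼ)` at `p` with respect to the standard global coordinates. Every tangent space
is identified with `Fin n → ℝ` through the coordinate frame. -/
structure Metric (n : ℕ) where
  /-- the component matrix at each point -/
  comp : (Fin n → ℝ) → Matrix (Fin n) (Fin n) ℝ
  smooth : ∀ i j, ContDiff ℝ ∞ (fun p => comp p i j)
  symm : ∀ p, (comp p).IsSymm
  nondegenerate : ∀ p, IsUnit (comp p).det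

variable {n : ℕ}

/-- The inner product `g_p(u, v)` of two tangent vectors at `p`. -/
def Metric.inner (g : Metric n) (p u v : Fin n → ℝ) : ℝ := u ⬝ᵥ (g.comp p *ᵥ v)

/-- The coordinate vector `∂ᵢ`. -/
def coordVec (i : Fin n) : Fin n → ℝ := Pi.single i 1

/-- The partial derivative `∂ᵢ f` at `p`. -/
def partialDeriv (i : Fin n) (f : (Fin n → ℝ) → ℝ) (p : Fin n → ℝ) : ℝ :=
  fderiv ℝ f p (coordVec i)

/-- Christoffel symbols of the second kind of the Levi-Civita connection,
`Γᵏᵢⱼ = ½ ∑ₗ gᵏˡ (∂ᵢ gⱼₗ + ∂ⱼ gᵢₗ - ∂ₗ gᵢⱼ)`. -/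
def Metric.christoffel (g : Metric n) (k i j : Fin n) (p : Fin n → ℝ) : ℝ :=
  (1 / 2) * ∑ l, (g.comp p)⁻¹ k l *
    (partialDeriv i (fun q => g.comp q j l) p + partialDeriv j (fun q => g.comp q i l) p
      - partialDeriv l (fun q => g.comp q i j) p)

/-- The Levi-Civita covariant derivative `∇_X Y` of vector fields. -/
def Metric.nabla (g : Metric n) (X Y : (Fin n → ℝ) → (Fin n → ℝ)) (p : Fin n → ℝ) : Fin n → ℝ :=
  fun k => fderiv ℝ (fun q => Y q k) p (X p)
    + ∑ i, ∑ j, g.christoffel k i j p * X p i * Y p j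

/-- The curvature operator on vector fields,
`R(X, Y) Z = ∇_X ∇_Y Z - ∇_Y ∇_X Z - ∇_[X,Y] Z`. -/
def Metric.curvField (g : Metric n) (X Y Z : (Fin n → ℝ) → (Fin n → ℝ)) :
    (Fin n → ℝ) → (Fin n → ℝ) :=
  g.nabla X (g.nabla Y Z) - g.nabla Y (g.nabla X Z) - g.nabla (VectorField.lieBracket ℝ X Y) Z

/-- The curvature operator `R(u, v) w` on tangent vectors at `p`, the trilinear extension of its
values `R(∂ᵢ, ∂ⱼ) ∂ₖ` on the coordinate fields. -/
def Metric.curv (g : Metric n) (p u v w : Fin n → ℝ) : Fin n → ℝ :=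
  fun l => ∑ i, ∑ j, ∑ k, u i * v j * w k *
    g.curvField (fun _ => coordVec i) (fun _ => coordVec j) (fun _ => coordVec k) p l

/-- The curvature tensor `R(u, v, w, s) = g(R(u, v) w, s)` at `p`. -/
def Metric.curvTensor (g : Metric n) (p u v w s : Fin n → ℝ) : ℝ :=
  g.inner p (g.curv p u v w) s

/-- The polarized Jacobi operator `J(u, v) : ξ ↦ ½ (R(ξ, u) v + R(ξ, v) u)` at `p`. -/
def Metric.jacobi (g : Metric n) (p u v : Fin n → ℝ) : Module.End ℝ (Fin n → ℝ) where
  toFun ξ := (1 / 2 : ℝ) • (g.curv p ξ u v + g.curv p ξ v u)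
  map_add' ξ η := by
    ext l
    simp only [Metric.curv, Pi.add_apply, Pi.smul_apply, smul_eq_mul, add_mul,
      Finset.sum_add_distrib]
    ring
  map_smul' c ξ := by
    ext l
    simp only [Metric.curv, Pi.add_apply, Pi.smul_apply, smul_eq_mul, RingHom.id_apply,
      mul_assoc, ← Finset.mul_sum]
    ring

/-- The Ricci form `ρ(u, v) = Tr J(u, v)` at `p`. -/
def Metric.ricciForm (g : Metric n) (p u v : Fin n → ℝ) : ℝ :=
  LinearMap.trace ℝ (Fin n → ℝ) (g.jacobi p u v)

/-- The Ricci operator at `p`, obtained from the Ricci form by raising an index: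
`g(ρ u, v) = ρ(u, v)`. -/
def Metric.ricci (g : Metric n) (p : Fin n → ℝ) : Module.End ℝ (Fin n → ℝ) :=
  Matrix.toLin' ((g.comp p)⁻¹ * Matrix.of fun i j => g.ricciForm p (coordVec i) (coordVec j))

/-- Jacobi--Videv: the Ricci operator commutes with every Jacobi operator `J(u) = J(u, u)`. -/
def Metric.IsJacobiVidev (g : Metric n) : Prop :=
  ∀ p u : Fin n → ℝ, g.jacobi p u u * g.ricci p = g.ricci p * g.jacobi p u u

/-- Curvature homogeneous: between any two tangent spaces there is a linear isometry that
identifies the curvature tensors. -/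
def Metric.IsCurvatureHomogeneous (g : Metric n) : Prop :=
  ∀ P Q : Fin n → ℝ, ∃ L : (Fin n → ℝ) ≃ₗ[ℝ] (Fin n → ℝ),
    (∀ u v, g.inner Q (L u) (L v) = g.inner P u v) ∧
    ∀ u v w s, g.curvTensor Q (L u) (L v) (L w) (L s) = g.curvTensor P u v w s

/-- `Φ` is a (global) isometry from `(ℝⁿ, g)` onto `(ℝⁿ, h)`: a smooth diffeomorphism that pulls
`h` back to `g`. -/
structure IsIsometry (g h : Metric n) (Φ : (Fin n → ℝ) ≃ (Fin n → ℝ)) : Prop where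
  smooth : ContDiff ℝ ∞ Φ
  smooth_symm : ContDiff ℝ ∞ Φ.symm
  pullback : ∀ p u v, h.inner (Φ p) (fderiv ℝ Φ p u) (fderiv ℝ Φ p v) = g.inner p u v

/-- `(ℝⁿ, g)` and `(ℝⁿ, h)` are isometric. -/
def Isometric (g h : Metric n) : Prop := ∃ Φ, IsIsometry g h Φ

/-- Homogeneous: the group of isometries acts transitively. -/
def Metric.IsHomogeneous (g : Metric n) : Prop :=
  ∀ P Q : Fin n → ℝ, ∃ Φ, IsIsometry g g Φ ∧ Φ P = Q

/-- `Φ` is a local isometry from the open subset `U` of `(ℝⁿ, g)` to `(ℝⁿ, h)`: it is smooth and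
pulls `h` back to `g` on `U` (so, by the inverse function theorem, it is a local diffeomorphism
there). -/
structure IsLocalIsometryOn (g h : Metric n) (U : Set (Fin n → ℝ))
    (Φ : (Fin n → ℝ) → (Fin n → ℝ)) : Prop where
  isOpen : IsOpen U
  smooth : ContDiffOn ℝ ∞ Φ U
  pullback : ∀ p ∈ U, ∀ u v,
    h.inner (Φ p) (fderiv ℝ Φ p u) (fderiv ℝ Φ p v) = g.inner p u v

/-- The metric on `ℝ⁴` with coordinates `(x, y, z, x̄)`, indexed by `0, 1, 2, 3`, whose non-zero
components are `g(∂x, ∂x̄) = g(∂y, ∂y) = g(∂z, ∂z) = 1` and `g(∂x, ∂z) = 2 φ(y)`. -/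
def phiMetric (φ : ℝ → ℝ) (hφ : ContDiff ℝ ∞ φ) : Metric 4 where
  comp p := !![0, 0, 2 * φ (p 1), 1;
               0, 1, 0, 0;
               2 * φ (p 1), 0, 1, 0;
               1, 0, 0, 0]
  smooth i j := by
    have h : ContDiff ℝ ∞ (fun p : Fin 4 → ℝ => 2 * φ (p 1)) :=
      contDiff_const.mul (hφ.comp (contDiff_apply ℝ ℝ (1 : Fin 4)))
    fin_cases i <;> fin_cases j <;> first | exact contDiff_const | exact h
  symm p := by
    ext i j
    fin_cases i <;> fin_cases j <;> rfl
  nondegenerate p := by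
    simp [Matrix.det_succ_row_zero, Fin.sum_univ_succ, Fin.succAbove]

/-- The case `φ(y) = e^{by}`. -/
def expMetric (b : ℝ) : Metric 4 :=
  phiMetric (fun y => Real.exp (b * y)) (Real.contDiff_exp.comp (contDiff_const.mul contDiff_id))

/-- `α_φ = (φ')² / (φ'')²`, as a function of `y`. -/
def alpha (φ : ℝ → ℝ) (y : ℝ) : ℝ := deriv φ y ^ 2 / deriv (deriv φ) y ^ 2

end PseudoRiem

end

/-! All curvature data are explicit: with `p 1 = y`, the curvature is polynomial in φ, φ' and φ'',
and ρ sends ∂x into span(∂z, ∂x̄), ∂z to -φ''∂x̄, and kills ∂y and ∂x̄. This gives the ranks, and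
testing a Jacobi operator on ∂y refutes Jacobi–Videv. The invariance of α rests on the identity R(u,
ρu, ρu, u) = α g(ρu, ρu)², where g(ρu, ρu) = (φ'' u₀)². Both sides are built from the metric and the
curvature, so α is preserved by every linear isometry matching curvature tensors
(`IsModelIso.alpha_eq`). Differentials of local isometries are such maps (`fderiv_christoffelCurv`,
`IsLocalIsometryOn.isModelIso`). Curvature homogeneity thus makes α constant, which forces φ = a
e^{cy} + B (`exists_exp_of_alpha_const`). Affine changes of coordinates normalise this to e^{|c|y}
(`exists_isometric_expMetric`), whose metric has a transitive group of affine isometries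
(`isHomogeneous_expMetric`). Transitivity gives curvature homogeneity by naturality again. -/

namespace PseudoRiem

/-! ### Local isometries preserve the connection and its curvature. -/

section Naturality

variable {E : Type*} [NormedAddCommGroup E] [NormedSpace ℝ E]

/-- The curvature `R(u, v) w` of the connection on a normed space with Christoffel map `B`. -/
noncomputable def christoffelCurv (B : E → E →L[ℝ] E →L[ℝ] E) (p u v w : E) : E :=
  fderiv ℝ B p u v w - fderiv ℝ B p v u w + B p u (B p v w) - B p v (B p u w)

/-- `B` is symmetric and compatible with `g`: the Levi-Civita Christoffel map of `g`. -/
structure IsLeviCivita (g : E → E →L[ℝ] E →L[ℝ] ℝ) (B : E → E →L[ℝ] E →L[ℝ] E) : Prop where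
  differentiable_metric : Differentiable ℝ g
  differentiable : Differentiable ℝ B
  metric_symm : ∀ p u v, g p u v = g p v u
  symm : ∀ p u v, B p u v = B p v u
  compat : ∀ p w u v, fderiv ℝ g p w u v = g p (B p w u) v + g p u (B p w v)

variable {g h : E → E →L[ℝ] E →L[ℝ] ℝ} {B C : E → E →L[ℝ] E →L[ℝ] E} {U : Set E} {Φ : E → E}

/-- Koszul's uniqueness argument. Let T be the failure of the equation. Then h(T(a, b), Φ'c) is
symmetric in a, b because both connections are torsion-free, and skew in b, c because both are
metric. A trilinear form with both symmetries vanishes; surjectivity of Φ' and nondegeneracy of h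
then give T = 0. -/
theorem fderiv_fderiv_of_pullback (hB : IsLeviCivita g B) (hC : IsLeviCivita h C)
    (hU : IsOpen U) (hΦ : ContDiffOn ℝ ∞ Φ U)
    (hpull : ∀ p ∈ U, ∀ u v, h (Φ p) (fderiv ℝ Φ p u) (fderiv ℝ Φ p v) = g p u v)
    (hnd : ∀ p u, (∀ v, h p u v = 0) → u = 0)
    (hsurj : ∀ p ∈ U, Function.Surjective (fderiv ℝ Φ p)) {p : E} (hp : p ∈ U) (w u : E) :
    fderiv ℝ (fderiv ℝ Φ) p w u =
      fderiv ℝ Φ p (B p w u) - C (Φ p) (fderiv ℝ Φ p w) (fderiv ℝ Φ p u) := by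
  have hat : ContDiffAt ℝ ∞ Φ p := hΦ.contDiffAt (hU.mem_nhds hp)
  have hd1 : HasFDerivAt Φ (fderiv ℝ Φ p) p := (hat.differentiableAt (by simp)).hasFDerivAt
  have hF : ContDiffAt ℝ ∞ (fderiv ℝ Φ) p := hat.fderiv_right (by simp)
  have hd2 : HasFDerivAt (fderiv ℝ Φ) (fderiv ℝ (fderiv ℝ Φ) p) p :=
    (hF.differentiableAt (by simp)).hasFDerivAt
  have hsym : ∀ a b, fderiv ℝ (fderiv ℝ Φ) p a b = fderiv ℝ (fderiv ℝ Φ) p b a :=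
    fun a b => (hat.isSymmSndFDerivAt (by simpa using WithTop.coe_le_coe.2 (le_top (a := (2 : ℕ∞))))) a b
  -- Skewness: differentiate the pullback identity in direction a and apply both compatibilities.
  have key : ∀ a b c, h (Φ p) (fderiv ℝ (fderiv ℝ Φ) p a b
        + C (Φ p) (fderiv ℝ Φ p a) (fderiv ℝ Φ p b) - fderiv ℝ Φ p (B p a b)) (fderiv ℝ Φ p c)
      + h (Φ p) (fderiv ℝ (fderiv ℝ Φ) p a c
        + C (Φ p) (fderiv ℝ Φ p a) (fderiv ℝ Φ p c) - fderiv ℝ Φ p (B p a c)) (fderiv ℝ Φ p b)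
      = 0 := by
    intro a b c
    have hh : HasFDerivAt (fun q => h (Φ q)) ((fderiv ℝ h (Φ p)).comp (fderiv ℝ Φ p)) p :=
      HasFDerivAt.comp (g := h) p (hC.differentiable_metric (Φ p)).hasFDerivAt hd1
    have h1 := (hh.clm_apply (hd2.clm_apply (hasFDerivAt_const b p))).clm_apply
      (hd2.clm_apply (hasFDerivAt_const c p))
    have h2 := ((hB.differentiable_metric p).hasFDerivAt.clm_apply
      (hasFDerivAt_const b p)).clm_apply (hasFDerivAt_const c p)
    have heq : (fun q => h (Φ q) (fderiv ℝ Φ q b) (fderiv ℝ Φ q c)) =ᶠ[nhds p]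
        fun q => g q b c := by
      filter_upwards [hU.mem_nhds hp] with q hq using hpull q hq b c
    have h3 := DFunLike.congr_fun (h1.unique (h2.congr_of_eventuallyEq heq)) a
    simp at h3
    rw [hC.compat, hB.compat, ← hpull p hp, ← hpull p hp] at h3
    simp only [map_add, map_sub, add_apply, sub_apply]
    rw [hC.metric_symm _ (fderiv ℝ Φ p b) (fderiv ℝ (fderiv ℝ Φ) p a c),
      hC.metric_symm _ (fderiv ℝ Φ p b) (C (Φ p) (fderiv ℝ Φ p a) (fderiv ℝ Φ p c)),
      hC.metric_symm _ (fderiv ℝ Φ p b) (fderiv ℝ Φ p (B p a c))] at h3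
    linarith
  have hT : ∀ a b, fderiv ℝ (fderiv ℝ Φ) p a b
        + C (Φ p) (fderiv ℝ Φ p a) (fderiv ℝ Φ p b) - fderiv ℝ Φ p (B p a b)
      = fderiv ℝ (fderiv ℝ Φ) p b a
        + C (Φ p) (fderiv ℝ Φ p b) (fderiv ℝ Φ p a) - fderiv ℝ Φ p (B p b a) := by
    intro a b
    rw [hsym a b, hC.symm _ (fderiv ℝ Φ p a), hB.symm _ a b]
  have hzero := hnd (Φ p) (fderiv ℝ (fderiv ℝ Φ) p w u
        + C (Φ p) (fderiv ℝ Φ p w) (fderiv ℝ Φ p u) - fderiv ℝ Φ p (B p w u)) (by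
    intro v'
    obtain ⟨v, rfl⟩ := hsurj p hp v'
    have k1 := key w u v
    have k2 := key u v w
    have k3 := key v w u
    rw [hT v w] at k3
    rw [hT u v] at k2
    rw [hT u w] at k2
    linarith)
  rw [← sub_eq_zero, ← hzero]
  abel

/-- A local isometry intertwines the curvature operators. -/
theorem fderiv_christoffelCurv (hB : IsLeviCivita g B) (hC : IsLeviCivita h C)
    (hU : IsOpen U) (hΦ : ContDiffOn ℝ ∞ Φ U)
    (hpull : ∀ p ∈ U, ∀ u v, h (Φ p) (fderiv ℝ Φ p u) (fderiv ℝ Φ p v) = g p u v)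
    (hnd : ∀ p u, (∀ v, h p u v = 0) → u = 0)
    (hsurj : ∀ p ∈ U, Function.Surjective (fderiv ℝ Φ p)) {p : E} (hp : p ∈ U) (u v w : E) :
    fderiv ℝ Φ p (christoffelCurv B p u v w) =
      christoffelCurv C (Φ p) (fderiv ℝ Φ p u) (fderiv ℝ Φ p v) (fderiv ℝ Φ p w) := by
  have hat : ContDiffAt ℝ ∞ Φ p := hΦ.contDiffAt (hU.mem_nhds hp)
  have hd1 : HasFDerivAt Φ (fderiv ℝ Φ p) p := (hat.differentiableAt (by simp)).hasFDerivAt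
  have hF : ContDiffAt ℝ ∞ (fderiv ℝ Φ) p := hat.fderiv_right (by simp)
  have hd2 : HasFDerivAt (fderiv ℝ Φ) (fderiv ℝ (fderiv ℝ Φ) p) p :=
    (hF.differentiableAt (by simp)).hasFDerivAt
  have hF2 : ContDiffAt ℝ ∞ (fderiv ℝ (fderiv ℝ Φ)) p := hF.fderiv_right (by simp)
  have hd3 : HasFDerivAt (fderiv ℝ (fderiv ℝ Φ)) (fderiv ℝ (fderiv ℝ (fderiv ℝ Φ)) p) p :=
    (hF2.differentiableAt (by simp)).hasFDerivAt
  have hsym : ∀ a b, fderiv ℝ (fderiv ℝ (fderiv ℝ Φ)) p a b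
      = fderiv ℝ (fderiv ℝ (fderiv ℝ Φ)) p b a :=
    fun a b => (hF.isSymmSndFDerivAt (by simpa using WithTop.coe_le_coe.2 (le_top (a := (2 : ℕ∞))))) a b
  have hess := fun a b => fderiv_fderiv_of_pullback hB hC hU hΦ hpull hnd hsurj hp a b
  have hCΦ : HasFDerivAt (fun q => C (Φ q)) ((fderiv ℝ C (Φ p)).comp (fderiv ℝ Φ p)) p :=
    HasFDerivAt.comp (g := C) p (hC.differentiable (Φ p)).hasFDerivAt hd1
  -- The derivative of the Hessian equation in direction a.
  have third : ∀ a b c, fderiv ℝ (fderiv ℝ (fderiv ℝ Φ)) p a b c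
      = fderiv ℝ (fderiv ℝ Φ) p a (B p b c) + fderiv ℝ Φ p (fderiv ℝ B p a b c)
        - fderiv ℝ C (Φ p) (fderiv ℝ Φ p a) (fderiv ℝ Φ p b) (fderiv ℝ Φ p c)
        - C (Φ p) (fderiv ℝ (fderiv ℝ Φ) p a b) (fderiv ℝ Φ p c)
        - C (Φ p) (fderiv ℝ Φ p b) (fderiv ℝ (fderiv ℝ Φ) p a c) := by
    intro a b c
    have h1 := (hd3.clm_apply (hasFDerivAt_const b p)).clm_apply (hasFDerivAt_const c p)
    have h2 := (hd2.clm_apply (((hB.differentiable p).hasFDerivAt.clm_apply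
      (hasFDerivAt_const b p)).clm_apply (hasFDerivAt_const c p))).sub
      ((hCΦ.clm_apply (hd2.clm_apply (hasFDerivAt_const b p))).clm_apply
        (hd2.clm_apply (hasFDerivAt_const c p)))
    have heq : (fun q => fderiv ℝ (fderiv ℝ Φ) q b c) =ᶠ[nhds p]
        fun q => fderiv ℝ Φ q (B q b c) - C (Φ q) (fderiv ℝ Φ q b) (fderiv ℝ Φ q c) := by
      filter_upwards [hU.mem_nhds hp] with q hq using
        fderiv_fderiv_of_pullback hB hC hU hΦ hpull hnd hsurj hq b c
    have h3 := DFunLike.congr_fun (h1.unique (h2.congr_of_eventuallyEq heq)) a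
    simp at h3
    rw [h3]
    abel
  -- Third derivatives agree under swapping u and v. Once second derivatives are eliminated by the
  -- Hessian equation, this integrability condition is the equality of curvatures.
  have e1 := third u v w
  have e2 := third v u w
  rw [hsym u v, e2] at e1
  rw [hess u (B p v w), hess v (B p u w), hess u w, hess v w, hess u v, hess v u,
    hB.symm p v u, hC.symm (Φ p) (fderiv ℝ Φ p v) (fderiv ℝ Φ p u)] at e1
  simp only [map_sub] at e1
  rw [← sub_eq_zero] at e1
  simp only [christoffelCurv, map_add, map_sub]
  rw [← sub_eq_zero, ← neg_eq_zero, ← e1]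
  abel

end Naturality

set_option maxSynthPendingDepth 3

/-! ### Connection, curvature and Ricci operator of `phiMetric` in closed form. -/

section Explicit

/-- The bilinear map `(u, v) ↦ uᵢ vⱼ ∂ₖ`. -/
noncomputable def elemBilin (i j k : Fin 4) : (Fin 4 → ℝ) →L[ℝ] (Fin 4 → ℝ) →L[ℝ] (Fin 4 → ℝ) :=
  (ContinuousLinearMap.proj (R := ℝ) (φ := fun _ : Fin 4 => ℝ) i).smulRight
    ((ContinuousLinearMap.proj (R := ℝ) (φ := fun _ : Fin 4 => ℝ) j).smulRight (coordVec k))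

/-- The bilinear form `(u, v) ↦ uᵢ vⱼ`. -/
noncomputable def elemForm (i j : Fin 4) : (Fin 4 → ℝ) →L[ℝ] (Fin 4 → ℝ) →L[ℝ] ℝ :=
  (ContinuousLinearMap.proj (R := ℝ) (φ := fun _ : Fin 4 => ℝ) i).smulRight
    (ContinuousLinearMap.proj (R := ℝ) (φ := fun _ : Fin 4 => ℝ) j)

@[simp] theorem elemBilin_apply (i j k : Fin 4) (u v : Fin 4 → ℝ) :
    elemBilin i j k u v = (u i * v j) • coordVec k := by
  simp [elemBilin, smul_smul]

@[simp] theorem elemForm_apply (i j : Fin 4) (u v : Fin 4 → ℝ) :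
    elemForm i j u v = u i * v j := by
  simp [elemForm]

/-- The Christoffel map of `phiMetric φ`. -/
noncomputable def phiChristoffel (φ : ℝ → ℝ) (p : Fin 4 → ℝ) :
    (Fin 4 → ℝ) →L[ℝ] (Fin 4 → ℝ) →L[ℝ] (Fin 4 → ℝ) :=
  deriv φ (p 1) • (elemBilin 0 1 2 + elemBilin 1 0 2 + elemBilin 1 2 3 + elemBilin 2 1 3
      - elemBilin 0 2 1 - elemBilin 2 0 1)
    - (2 * φ (p 1) * deriv φ (p 1)) • (elemBilin 0 1 3 + elemBilin 1 0 3)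

/-- `phiMetric φ` as a map into bilinear forms. -/
noncomputable def phiForm (φ : ℝ → ℝ) (p : Fin 4 → ℝ) :
    (Fin 4 → ℝ) →L[ℝ] (Fin 4 → ℝ) →L[ℝ] ℝ :=
  (elemForm 0 3 + elemForm 3 0 + elemForm 1 1 + elemForm 2 2)
    + (2 * φ (p 1)) • (elemForm 0 2 + elemForm 2 0)

theorem phiChristoffel_apply (φ : ℝ → ℝ) (p u v : Fin 4 → ℝ) :
    phiChristoffel φ p u v =
      ![0, - deriv φ (p 1) * (u 0 * v 2 + u 2 * v 0), deriv φ (p 1) * (u 0 * v 1 + u 1 * v 0),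
        deriv φ (p 1) * (u 1 * v 2 + u 2 * v 1)
          - 2 * φ (p 1) * deriv φ (p 1) * (u 0 * v 1 + u 1 * v 0)] := by
  ext l
  fin_cases l <;> simp [phiChristoffel, coordVec] <;> ring

theorem phiForm_apply (φ : ℝ → ℝ) (p u v : Fin 4 → ℝ) :
    phiForm φ p u v = u 0 * v 3 + u 3 * v 0 + u 1 * v 1 + u 2 * v 2
      + 2 * φ (p 1) * (u 0 * v 2 + u 2 * v 0) := by
  simp [phiForm]
  ring

variable {φ : ℝ → ℝ} (hφ : ContDiff ℝ ∞ φ)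

include hφ in
theorem hasDerivAt_deriv (y : ℝ) : HasDerivAt (deriv φ) (deriv (deriv φ) y) y :=
  (((contDiff_infty_iff_deriv.1 hφ).2.differentiable (by simp)) y).hasDerivAt

include hφ in
theorem hasDerivAt_self (y : ℝ) : HasDerivAt φ (deriv φ y) y :=
  ((hφ.differentiable (by simp)) y).hasDerivAt

theorem hasFDerivAt_comp_coord {f : ℝ → ℝ} {f' : ℝ} {n : ℕ} (i : Fin n) {p : Fin n → ℝ}
    (hf : HasDerivAt f f' (p i)) :
    HasFDerivAt (fun q : Fin n → ℝ => f (q i))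
      (f' • ContinuousLinearMap.proj (R := ℝ) (φ := fun _ : Fin n => ℝ) i) p :=
  hf.comp_hasFDerivAt p (hasFDerivAt_apply i p)

include hφ in
theorem hasFDerivAt_phiChristoffel (p : Fin 4 → ℝ) :
    HasFDerivAt (phiChristoffel φ)
      ((deriv (deriv φ) (p 1) • ContinuousLinearMap.proj (R := ℝ)
          (φ := fun _ : Fin 4 => ℝ) 1).smulRight
        (elemBilin 0 1 2 + elemBilin 1 0 2 + elemBilin 1 2 3 + elemBilin 2 1 3
          - elemBilin 0 2 1 - elemBilin 2 0 1)
      - ((2 * deriv φ (p 1) * deriv φ (p 1) + 2 * φ (p 1) * deriv (deriv φ) (p 1)) •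
          ContinuousLinearMap.proj (R := ℝ) (φ := fun _ : Fin 4 => ℝ) 1).smulRight
        (elemBilin 0 1 3 + elemBilin 1 0 3)) p :=
  ((hasFDerivAt_comp_coord 1 (hasDerivAt_deriv hφ (p 1))).smul_const _).sub
    ((hasFDerivAt_comp_coord 1 (((hasDerivAt_self hφ (p 1)).const_mul 2).mul
      (hasDerivAt_deriv hφ (p 1)))).smul_const _)

include hφ in
theorem hasFDerivAt_phiForm (p : Fin 4 → ℝ) :
    HasFDerivAt (phiForm φ)
      (((2 * deriv φ (p 1)) • ContinuousLinearMap.proj (R := ℝ)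
          (φ := fun _ : Fin 4 => ℝ) 1).smulRight (elemForm 0 2 + elemForm 2 0)) p :=
  ((hasFDerivAt_comp_coord 1 ((hasDerivAt_self hφ (p 1)).const_mul 2)).smul_const _).const_add _

include hφ in
theorem isLeviCivita_phi : IsLeviCivita (phiForm φ) (phiChristoffel φ) where
  differentiable_metric p := (hasFDerivAt_phiForm hφ p).differentiableAt
  differentiable p := (hasFDerivAt_phiChristoffel hφ p).differentiableAt
  metric_symm p u v := by simp only [phiForm_apply]; ring
  symm p u v := by
    ext l
    fin_cases l <;> simp [phiChristoffel_apply, -mul_eq_mul_left_iff] <;> ring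
  compat p w u v := by
    rw [(hasFDerivAt_phiForm hφ p).fderiv]
    simp [phiForm_apply, phiChristoffel_apply]
    ring

include hφ in
theorem fderiv_phiChristoffel_apply (p w u v : Fin 4 → ℝ) :
    fderiv ℝ (phiChristoffel φ) p w u v =
      ![0, - (deriv (deriv φ) (p 1) * w 1) * (u 0 * v 2 + u 2 * v 0),
        (deriv (deriv φ) (p 1) * w 1) * (u 0 * v 1 + u 1 * v 0),
        (deriv (deriv φ) (p 1) * w 1) * (u 1 * v 2 + u 2 * v 1)
          - 2 * (deriv φ (p 1) ^ 2 + φ (p 1) * deriv (deriv φ) (p 1)) * w 1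
            * (u 0 * v 1 + u 1 * v 0)] := by
  rw [(hasFDerivAt_phiChristoffel hφ p).fderiv]
  ext l
  fin_cases l <;> simp [coordVec] <;> ring

include hφ in
theorem christoffelCurv_phi (p u v w : Fin 4 → ℝ) :
    christoffelCurv (phiChristoffel φ) p u v w =
      ![0,
        (u 0 * v 1 - u 1 * v 0) * (deriv (deriv φ) (p 1) * w 2 - deriv φ (p 1) ^ 2 * w 0)
          - (u 1 * v 2 - u 2 * v 1) * (deriv (deriv φ) (p 1) * w 0),
        - (u 0 * v 1 - u 1 * v 0) * (deriv (deriv φ) (p 1) * w 1)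
          - (u 0 * v 2 - u 2 * v 0) * (deriv φ (p 1) ^ 2 * w 0),
        (u 0 * v 1 - u 1 * v 0) *
            ((deriv φ (p 1) ^ 2 + 2 * φ (p 1) * deriv (deriv φ) (p 1)) * w 1)
          + (u 0 * v 2 - u 2 * v 0) * (deriv φ (p 1) ^ 2 * (w 2 + 2 * φ (p 1) * w 0))
          + (u 1 * v 2 - u 2 * v 1) * (deriv (deriv φ) (p 1) * w 1)] := by
  ext l
  simp only [christoffelCurv, fderiv_phiChristoffel_apply hφ, phiChristoffel_apply]
  fin_cases l <;> simp <;> ring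

theorem inner_phi (p u v : Fin 4 → ℝ) : (phiMetric φ hφ).inner p u v = phiForm φ p u v := by
  simp [Metric.inner, phiMetric, phiForm_apply, Matrix.mulVec, dotProduct, Fin.sum_univ_four]
  ring

theorem inv_comp_phi (p : Fin 4 → ℝ) : ((phiMetric φ hφ).comp p)⁻¹ =
    !![0, 0, 0, 1; 0, 1, 0, 0; 0, 0, 1, -2 * φ (p 1); 1, 0, -2 * φ (p 1), 4 * φ (p 1) ^ 2] := by
  apply Matrix.inv_eq_right_inv
  ext i j
  fin_cases i <;> fin_cases j <;>
    simp [phiMetric, Matrix.mul_apply, Fin.sum_univ_four] <;> ring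

theorem partialDeriv_comp_phi (i j l : Fin 4) (p : Fin 4 → ℝ) :
    partialDeriv i (fun q => (phiMetric φ hφ).comp q j l) p =
      if i = 1 ∧ ((j = 0 ∧ l = 2) ∨ (j = 2 ∧ l = 0)) then 2 * deriv φ (p 1) else 0 := by
  have h := (hasFDerivAt_comp_coord 1 ((hasDerivAt_self hφ (p 1)).const_mul 2)).fderiv
  fin_cases j <;> fin_cases l <;>
    simp [partialDeriv, phiMetric, h, coordVec, Pi.single_apply, eq_comm]

theorem christoffel_phi (k i j : Fin 4) (p : Fin 4 → ℝ) :
    (phiMetric φ hφ).christoffel k i j p = phiChristoffel φ p (coordVec i) (coordVec j) k := by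
  rw [phiChristoffel_apply]
  simp only [Metric.christoffel, inv_comp_phi, partialDeriv_comp_phi, Fin.sum_univ_four]
  fin_cases i <;> fin_cases j <;> fin_cases k <;> simp [coordVec] <;> ring

theorem sum_smul_coordVec {n : ℕ} (u : Fin n → ℝ) : ∑ i, u i • coordVec i = u := by
  ext l
  simp [coordVec, Pi.single_apply]

theorem nabla_phi (X Y : (Fin 4 → ℝ) → (Fin 4 → ℝ)) (p : Fin 4 → ℝ)
    (hY : DifferentiableAt ℝ Y p) :
    (phiMetric φ hφ).nabla X Y p = fderiv ℝ Y p (X p) + phiChristoffel φ p (X p) (Y p) := by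
  ext k
  have h : phiChristoffel φ p (X p) (Y p)
      = ∑ i, ∑ j, (X p i * Y p j) • phiChristoffel φ p (coordVec i) (coordVec j) := by
    conv_lhs => rw [← sum_smul_coordVec (X p), ← sum_smul_coordVec (Y p)]
    simp only [map_sum, map_smul, sum_apply, smul_apply,
      Finset.smul_sum, smul_smul]
    rw [Finset.sum_comm]
    simp only [mul_comm]
  have h1 : fderiv ℝ (fun q => Y q k) p (X p) = fderiv ℝ Y p (X p) k := by
    rw [((hasFDerivAt_pi'.1 hY.hasFDerivAt) k).fderiv]
    rfl
  rw [Metric.nabla, h1, Pi.add_apply, h]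
  simp only [christoffel_phi, Finset.sum_apply, Pi.smul_apply, smul_eq_mul]
  congr 1
  refine Finset.sum_congr rfl fun i _ => Finset.sum_congr rfl fun j _ => ?_
  ring

/-- Constant fields commute, so only the two iterated covariant derivatives contribute. -/
theorem curvField_phi (u v w p : Fin 4 → ℝ) :
    (phiMetric φ hφ).curvField (fun _ => u) (fun _ => v) (fun _ => w) p
      = christoffelCurv (phiChristoffel φ) p u v w := by
  have hconst : ∀ u w : Fin 4 → ℝ, (phiMetric φ hφ).nabla (fun _ => u) (fun _ => w)
      = fun q => phiChristoffel φ q u w := by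
    intro u w
    funext q
    rw [nabla_phi _ _ _ _ (differentiableAt_const w)]
    simp
  have hd : ∀ v w : Fin 4 → ℝ, HasFDerivAt (fun q => phiChristoffel φ q v w)
      (((fderiv ℝ (phiChristoffel φ) p).flip v).flip w) p := by
    intro v w
    have := ((((isLeviCivita_phi hφ).differentiable p).hasFDerivAt.clm_apply
      (hasFDerivAt_const v p))).clm_apply (hasFDerivAt_const w p)
    simpa using this
  have hbr : VectorField.lieBracket ℝ (fun _ : Fin 4 → ℝ => u) (fun _ => v) = fun _ => 0 := by
    funext q
    simp [VectorField.lieBracket]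
  simp only [Metric.curvField, hbr, hconst, Pi.sub_apply]
  rw [nabla_phi _ _ _ _ (hd v w).differentiableAt, nabla_phi _ _ _ _ (hd u w).differentiableAt,
    (hd v w).fderiv, (hd u w).fderiv]
  simp only [christoffelCurv, map_zero, zero_apply,
    ContinuousLinearMap.flip_apply]
  abel

theorem curv_phi (p u v w : Fin 4 → ℝ) :
    (phiMetric φ hφ).curv p u v w = christoffelCurv (phiChristoffel φ) p u v w := by
  ext l
  simp only [Metric.curv, curvField_phi, christoffelCurv_phi hφ, Fin.sum_univ_four]
  fin_cases l <;> simp [coordVec] <;> ring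

theorem ricciForm_phi (p u v : Fin 4 → ℝ) : (phiMetric φ hφ).ricciForm p u v =
    2 * deriv φ (p 1) ^ 2 * (u 0 * v 0) - deriv (deriv φ) (p 1) * (u 0 * v 2 + u 2 * v 0) := by
  rw [Metric.ricciForm, LinearMap.trace_eq_matrix_trace ℝ (Pi.basisFun ℝ (Fin 4))]
  simp [Matrix.trace, Fin.sum_univ_four, Metric.jacobi, curv_phi,
    christoffelCurv_phi hφ]
  ring

theorem ricci_phi (p u : Fin 4 → ℝ) : (phiMetric φ hφ).ricci p u =
    ![0, 0, - deriv (deriv φ) (p 1) * u 0,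
      (2 * deriv φ (p 1) ^ 2 + 2 * φ (p 1) * deriv (deriv φ) (p 1)) * u 0
        - deriv (deriv φ) (p 1) * u 2] := by
  ext l
  simp only [Metric.ricci, inv_comp_phi, ricciForm_phi, Matrix.toLin'_apply]
  fin_cases l <;>
    simp [Matrix.mulVec, dotProduct, Matrix.mul_apply, Fin.sum_univ_four, coordVec] <;> ring

end Explicit

/-! ### Linear maps identifying metric and curvature tensor at two points. -/

section Models

variable {n : ℕ}

theorem Metric.inner_sub_left (g : Metric n) (p u u' v : Fin n → ℝ) :
    g.inner p (u - u') v = g.inner p u v - g.inner p u' v := by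
  simp [Metric.inner, sub_dotProduct]

theorem Metric.eq_zero_of_inner (g : Metric n) {p u : Fin n → ℝ}
    (h : ∀ v, g.inner p u v = 0) : u = 0 :=
  Matrix.separatingLeft_def.1
    (Matrix.nondegenerate_of_det_ne_zero (g.nondegenerate p).ne_zero).separatingLeft u h

theorem Metric.eq_of_inner (g : Metric n) {p u u' : Fin n → ℝ}
    (h : ∀ v, g.inner p u v = g.inner p u' v) : u = u' :=
  sub_eq_zero.1 (g.eq_zero_of_inner (p := p) fun v => by rw [g.inner_sub_left, h, sub_self])

/-- `L` identifies the inner product and the curvature tensor of `g` at `P` with those of `h`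
at `Q`. -/
structure IsModelIso (g h : Metric n) (P Q : Fin n → ℝ)
    (L : (Fin n → ℝ) ≃ₗ[ℝ] (Fin n → ℝ)) : Prop where
  inner : ∀ u v, h.inner Q (L u) (L v) = g.inner P u v
  curvTensor : ∀ u v w s,
    h.curvTensor Q (L u) (L v) (L w) (L s) = g.curvTensor P u v w s

variable {g h : Metric n} {P Q : Fin n → ℝ} {L : (Fin n → ℝ) ≃ₗ[ℝ] (Fin n → ℝ)}

theorem IsModelIso.curv (hL : IsModelIso g h P Q L) (u v w : Fin n → ℝ) :
    h.curv Q (L u) (L v) (L w) = L (g.curv P u v w) := by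
  refine h.eq_of_inner (p := Q) fun s => ?_
  obtain ⟨s, rfl⟩ := L.surjective s
  rw [hL.inner]
  exact hL.curvTensor u v w s

theorem IsModelIso.ricciForm (hL : IsModelIso g h P Q L) (u v : Fin n → ℝ) :
    h.ricciForm Q (L u) (L v) = g.ricciForm P u v := by
  have hJ : h.jacobi Q (L u) (L v) = L.conj (g.jacobi P u v) := by
    refine LinearMap.ext fun ξ => ?_
    obtain ⟨ξ, rfl⟩ := L.surjective ξ
    simp [LinearEquiv.conj_apply, Metric.jacobi, hL.curv]
  rw [Metric.ricciForm, hJ, LinearMap.trace_conj', Metric.ricciForm]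

end Models

/-! ### The invariant α, the ranks of powers of ρ, failure of Jacobi–Videv. -/

section PhiModels

variable {φ : ℝ → ℝ} (hφ : ContDiff ℝ ∞ φ) {ψ : ℝ → ℝ} (hψ : ContDiff ℝ ∞ ψ)

theorem inner_ricci_phi (p u v : Fin 4 → ℝ) :
    (phiMetric φ hφ).inner p ((phiMetric φ hφ).ricci p u) v
      = (phiMetric φ hφ).ricciForm p u v := by
  simp [inner_phi, ricci_phi, ricciForm_phi, phiForm_apply]
  ring

variable {hφ hψ} {P Q : Fin 4 → ℝ} {L : (Fin 4 → ℝ) ≃ₗ[ℝ] (Fin 4 → ℝ)}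

theorem IsModelIso.ricci (hL : IsModelIso (phiMetric φ hφ) (phiMetric ψ hψ) P Q L)
    (u : Fin 4 → ℝ) :
    (phiMetric ψ hψ).ricci Q (L u) = L ((phiMetric φ hφ).ricci P u) := by
  refine Metric.eq_of_inner (phiMetric ψ hψ) (p := Q) fun v => ?_
  obtain ⟨v, rfl⟩ := L.surjective v
  rw [hL.inner, inner_ricci_phi, inner_ricci_phi, hL.ricciForm]

/-- Of degree 4 in u₀, like the square of `inner_ricci_ricci_phi`, so the quotient does not depend
on u. -/
theorem curvTensor_ricci_phi (hφ : ContDiff ℝ ∞ φ) (p u : Fin 4 → ℝ) :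
    (phiMetric φ hφ).curvTensor p u ((phiMetric φ hφ).ricci p u)
      ((phiMetric φ hφ).ricci p u) u = (deriv φ (p 1) * deriv (deriv φ) (p 1) * u 0 ^ 2) ^ 2 := by
  simp [Metric.curvTensor, curv_phi, christoffelCurv_phi hφ, inner_phi, ricci_phi, phiForm_apply]
  ring

theorem inner_ricci_ricci_phi (hφ : ContDiff ℝ ∞ φ) (p u : Fin 4 → ℝ) :
    (phiMetric φ hφ).inner p ((phiMetric φ hφ).ricci p u) ((phiMetric φ hφ).ricci p u)
      = (deriv (deriv φ) (p 1) * u 0) ^ 2 := by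
  simp [inner_phi, ricci_phi, phiForm_apply]
  ring

/-- `α` is an invariant of the curvature model: it is `R(u, ρu, ρu, u) / g(ρu, ρu)²`. -/
theorem IsModelIso.alpha_eq (hL : IsModelIso (phiMetric φ hφ) (phiMetric ψ hψ) P Q L)
    (hφ2 : deriv (deriv φ) (P 1) ≠ 0) : alpha ψ (Q 1) = alpha φ (P 1) := by
  have h1 := hL.curvTensor (coordVec 0) ((phiMetric φ hφ).ricci P (coordVec 0))
    ((phiMetric φ hφ).ricci P (coordVec 0)) (coordVec 0)
  have h2 := hL.inner ((phiMetric φ hφ).ricci P (coordVec 0))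
    ((phiMetric φ hφ).ricci P (coordVec 0))
  rw [← hL.ricci, curvTensor_ricci_phi, curvTensor_ricci_phi] at h1
  rw [← hL.ricci, inner_ricci_ricci_phi, inner_ricci_ricci_phi] at h2
  have h0 : coordVec (0 : Fin 4) 0 = 1 := by simp [coordVec]
  rw [h0] at h1 h2
  -- The x-component of L ∂x is all that is needed of L; it cancels in the quotient.
  generalize L (coordVec 0) 0 = c at h1 h2
  -- g(ρu, ρu) is nonzero at P and preserved by L, so neither factor vanishes at Q.
  have hc : (deriv (deriv ψ) (Q 1) * c) ^ 2 ≠ 0 := by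
    rw [h2]
    simpa using hφ2
  have hψ2 : deriv (deriv ψ) (Q 1) ≠ 0 := by
    rintro h
    simp [h] at hc
  rw [alpha, alpha, div_eq_div_iff (pow_ne_zero 2 hψ2) (pow_ne_zero 2 hφ2)]
  apply mul_right_cancel₀ hc
  linear_combination (-deriv ψ (Q 1) ^ 2 * deriv (deriv ψ) (Q 1) ^ 2 * c ^ 2
    - deriv φ (P 1) ^ 2 * deriv (deriv ψ) (Q 1) ^ 2) * h2 + deriv (deriv ψ) (Q 1) ^ 2 * h1

theorem IsLocalIsometryOn.isModelIso {U : Set (Fin 4 → ℝ)} {Φ : (Fin 4 → ℝ) → (Fin 4 → ℝ)}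
    (hΦ : IsLocalIsometryOn (phiMetric φ hφ) (phiMetric ψ hψ) U Φ) {p : Fin 4 → ℝ} (hp : p ∈ U) :
    ∃ L : (Fin 4 → ℝ) ≃ₗ[ℝ] (Fin 4 → ℝ),
      IsModelIso (phiMetric φ hφ) (phiMetric ψ hψ) p (Φ p) L := by
  -- A kernel vector of Φ' would be g-orthogonal to everything; equality of dimensions then makes Φ'
  -- bijective.
  have hinj : ∀ p ∈ U, Function.Injective (fderiv ℝ Φ p : (Fin 4 → ℝ) →ₗ[ℝ] (Fin 4 → ℝ)) := by
    intro p hp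
    rw [injective_iff_map_eq_zero]
    intro u hu
    refine (phiMetric φ hφ).eq_zero_of_inner (p := p) fun v => ?_
    rw [← hΦ.pullback p hp]
    simp only [ContinuousLinearMap.coe_coe] at hu
    simp [hu, Metric.inner]
  have hsurj : ∀ p ∈ U, Function.Surjective (fderiv ℝ Φ p) := fun p hp =>
    LinearMap.injective_iff_surjective.1 (hinj p hp)
  refine ⟨LinearEquiv.ofInjectiveEndo _ (hinj p hp), hΦ.pullback p hp, fun u v w s => ?_⟩
  rw [Metric.curvTensor, Metric.curvTensor, ← hΦ.pullback p hp, curv_phi, curv_phi,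
    fderiv_christoffelCurv (isLeviCivita_phi hφ) (isLeviCivita_phi hψ) hΦ.isOpen hΦ.smooth
      (fun q hq u v => by simpa only [inner_phi] using hΦ.pullback q hq u v)
      (fun q u h => (phiMetric ψ hψ).eq_zero_of_inner (p := q) fun v => by
        rw [inner_phi, h]) hsurj hp]
  rfl

theorem IsIsometry.isModelIso {Φ : (Fin 4 → ℝ) ≃ (Fin 4 → ℝ)}
    (hΦ : IsIsometry (phiMetric φ hφ) (phiMetric ψ hψ) Φ) (p : Fin 4 → ℝ) :
    ∃ L : (Fin 4 → ℝ) ≃ₗ[ℝ] (Fin 4 → ℝ),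
      IsModelIso (phiMetric φ hφ) (phiMetric ψ hψ) p (Φ p) L :=
  IsLocalIsometryOn.isModelIso (U := Set.univ)
    ⟨isOpen_univ, hΦ.smooth.contDiffOn, fun p _ => hΦ.pullback p⟩ (Set.mem_univ p)

theorem range_ricci_phi (hφ : ContDiff ℝ ∞ φ) (hφ2 : deriv (deriv φ) (P 1) ≠ 0) :
    LinearMap.range ((phiMetric φ hφ).ricci P)
      = Submodule.span ℝ (Set.range ![coordVec (2 : Fin 4), coordVec 3]) := by
  ext v
  simp only [LinearMap.mem_range, Matrix.range_cons, Matrix.range_empty, Set.union_empty,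
    Set.singleton_union, Submodule.mem_span_pair, ricci_phi]
  constructor
  · rintro ⟨u, rfl⟩
    exact ⟨_, _, by ext l; fin_cases l <;> simp [coordVec] <;> rfl⟩
  · rintro ⟨a, b, rfl⟩
    -- The system is triangular: the ∂z coefficient a determines u₀, then the ∂x̄ coefficient b
    -- determines u₂.
    refine ⟨![- a / deriv (deriv φ) (P 1), 0,
      ((2 * deriv φ (P 1) ^ 2 + 2 * φ (P 1) * deriv (deriv φ) (P 1)) *
        (- a / deriv (deriv φ) (P 1)) - b) / deriv (deriv φ) (P 1), 0], ?_⟩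
    ext l
    fin_cases l <;> simp [coordVec] <;> field_simp <;> ring

theorem ricci_sq_phi (hφ : ContDiff ℝ ∞ φ) (p u : Fin 4 → ℝ) :
    ((phiMetric φ hφ).ricci p ^ 2) u = (deriv (deriv φ) (p 1) ^ 2 * u 0) • coordVec 3 := by
  rw [pow_two, Module.End.mul_apply, ricci_phi, ricci_phi]
  ext l
  fin_cases l <;> simp [coordVec]
  ring

theorem finrank_range_ricci_phi (hφ : ContDiff ℝ ∞ φ) (hφ2 : deriv (deriv φ) (P 1) ≠ 0) :
    Module.finrank ℝ (LinearMap.range ((phiMetric φ hφ).ricci P)) = 2 := by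
  rw [range_ricci_phi hφ hφ2, finrank_span_eq_card]
  · simp
  · rw [LinearIndependent.pair_iff]
    intro s t h
    have h2 := congrFun h 2
    have h3 := congrFun h 3
    simp [coordVec] at h2 h3
    exact ⟨h2, h3⟩

theorem finrank_range_ricci_sq_phi (hφ : ContDiff ℝ ∞ φ) (hφ2 : deriv (deriv φ) (P 1) ≠ 0) :
    Module.finrank ℝ (LinearMap.range ((phiMetric φ hφ).ricci P ^ 2)) = 1 := by
  have h : LinearMap.range ((phiMetric φ hφ).ricci P ^ 2)
      = Submodule.span ℝ {coordVec (3 : Fin 4)} := by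
    ext v
    simp only [LinearMap.mem_range, Submodule.mem_span_singleton, ricci_sq_phi]
    constructor
    · rintro ⟨u, rfl⟩
      exact ⟨_, rfl⟩
    · rintro ⟨a, rfl⟩
      refine ⟨(a / deriv (deriv φ) (P 1) ^ 2) • coordVec 0, ?_⟩
      congr 1
      simp [coordVec]
      field_simp
  rw [h, finrank_span_singleton]
  intro h
  simpa [coordVec] using congrFun h 3

theorem ricci_cube_phi (hφ : ContDiff ℝ ∞ φ) (p : Fin 4 → ℝ) :
    (phiMetric φ hφ).ricci p ^ 3 = 0 := by
  refine LinearMap.ext fun u => ?_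
  rw [pow_succ, Module.End.mul_apply, ricci_sq_phi, ricci_phi]
  simp

theorem not_isJacobiVidev_phi (hφ : ContDiff ℝ ∞ φ) (hφ2 : deriv (deriv φ) 0 ≠ 0) :
    ¬ (phiMetric φ hφ).IsJacobiVidev := by
  intro h
  -- With u = ∂x + ∂y at the origin, ρ∂y = 0, whereas ρJ(u)∂y = -φ''(0)²∂x̄.
  have h3 := congrFun (LinearMap.congr_fun (h 0 ![1, 1, 0, 0]) (coordVec 1)) 3
  simp [ricci_phi, Metric.jacobi, curv_phi, christoffelCurv_phi hφ, coordVec] at h3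
  exact hφ2 h3

end PhiModels

/-! ### Composition and inversion of isometries. -/

section Isometries

variable {n : ℕ} {g h k : Metric n} {Φ Ψ : (Fin n → ℝ) ≃ (Fin n → ℝ)}

theorem IsIsometry.trans (hΦ : IsIsometry g h Φ) (hΨ : IsIsometry h k Ψ) :
    IsIsometry g k (Φ.trans Ψ) where
  smooth := hΨ.smooth.comp hΦ.smooth
  smooth_symm := hΦ.smooth_symm.comp hΨ.smooth_symm
  pullback p u v := by
    rw [Equiv.coe_trans, fderiv_comp p (hΨ.smooth.differentiable (by simp) _)
      (hΦ.smooth.differentiable (by simp) _)]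
    simp [hΨ.pullback, hΦ.pullback]

theorem IsIsometry.symm (hΦ : IsIsometry g h Φ) : IsIsometry h g Φ.symm where
  smooth := hΦ.smooth_symm
  smooth_symm := hΦ.smooth
  pullback p u v := by
    have hid : ∀ u, fderiv ℝ Φ (Φ.symm p) (fderiv ℝ Φ.symm p u) = u := by
      intro u
      have h1 := fderiv_comp p (hΦ.smooth.differentiable (by simp) (Φ.symm p))
        (hΦ.smooth_symm.differentiable (by simp) p)
      rw [Equiv.self_comp_symm, fderiv_id] at h1
      exact (DFunLike.congr_fun h1 u).symm
    rw [← hΦ.pullback, hid, hid, Equiv.apply_symm_apply]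

end Isometries

/-! ### Affine isometries and homogeneity of the exponential model. -/

section AffineIsometries

/-- The linear part of `affineEquiv`. -/
def affineLinear (c m e₁ e₂ k : ℝ) : (Fin 4 → ℝ) →ₗ[ℝ] (Fin 4 → ℝ) where
  toFun p := ![c * p 0, e₁ * p 1, e₂ * p 2, m * p 3 + k * p 2]
  map_add' p q := by ext l; fin_cases l <;> simp <;> ring
  map_smul' a p := by ext l; fin_cases l <;> simp <;> ring

/-- The affine transformation
`(x, y, z, x̄) ↦ (c x + d₀, e₁ y + d₁, e₂ z + d₂, m x̄ + k z + d₃)`. -/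
def affineEquiv {c m e₁ e₂ : ℝ} (k : ℝ) (d : Fin 4 → ℝ) (hcm : c * m = 1) (h₁ : e₁ * e₁ = 1)
    (h₂ : e₂ * e₂ = 1) : (Fin 4 → ℝ) ≃ (Fin 4 → ℝ) where
  toFun p := affineLinear c m e₁ e₂ k p + d
  invFun q := ![m * (q 0 - d 0), e₁ * (q 1 - d 1), e₂ * (q 2 - d 2),
    c * (q 3 - d 3 - k * (e₂ * (q 2 - d 2)))]
  left_inv p := by
    ext l
    fin_cases l <;> simp [affineLinear]
    · linear_combination p 0 * hcm
    · linear_combination p 1 * h₁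
    · linear_combination p 2 * h₂
    · linear_combination p 3 * hcm - c * k * p 2 * h₂
  right_inv q := by
    ext l
    fin_cases l <;> simp [affineLinear]
    · linear_combination (q 0 - d 0) * hcm
    · linear_combination (q 1 - d 1) * h₁
    · linear_combination (q 2 - d 2) * h₂
    · linear_combination (q 3 - d 3 - k * (e₂ * (q 2 - d 2))) * hcm

/-- The dx dx̄, dy² and dz² coefficients of the pullback give `hcm`, `h₁` and `h₂`; the dx dz
coefficient, including the shear k, gives `h`. -/
theorem isIsometry_affineEquiv {φ ψ : ℝ → ℝ} (hφ : ContDiff ℝ ∞ φ) (hψ : ContDiff ℝ ∞ ψ)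
    {c m e₁ e₂ k : ℝ} {d : Fin 4 → ℝ} (hcm : c * m = 1) (h₁ : e₁ * e₁ = 1) (h₂ : e₂ * e₂ = 1)
    (h : ∀ y, c * k + 2 * ψ (e₁ * y + d 1) * c * e₂ = 2 * φ y) :
    IsIsometry (phiMetric φ hφ) (phiMetric ψ hψ) (affineEquiv k d hcm h₁ h₂) := by
  have hd : ∀ p, HasFDerivAt (affineEquiv k d hcm h₁ h₂)
      (affineLinear c m e₁ e₂ k).toContinuousLinearMap p := fun p =>
    (affineLinear c m e₁ e₂ k).toContinuousLinearMap.hasFDerivAt.add_const d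
  refine ⟨(affineLinear c m e₁ e₂ k).toContinuousLinearMap.contDiff.add contDiff_const, ?_,
    fun p u v => ?_⟩
  · rw [contDiff_pi]
    intro l
    fin_cases l <;> simp [affineEquiv] <;> fun_prop
  · rw [(hd p).fderiv]
    have hy := h (p 1)
    simp [inner_phi, phiForm_apply, affineEquiv, affineLinear]
    rw [show Matrix.vecHead (Matrix.vecTail d) = d 1 from rfl]
    linear_combination (u 0 * v 3 + u 3 * v 0) * hcm + u 1 * v 1 * h₁ + u 2 * v 2 * h₂
      + (u 0 * v 2 + u 2 * v 0) * hy

/-- Translating y by t multiplies e^{by} by e^{bt}; scaling x by e^{-bt} and x̄ by e^{bt}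
compensates. Translations in x, z, x̄ are free. -/
theorem isHomogeneous_expMetric (b : ℝ) : (expMetric b).IsHomogeneous := by
  intro P Q
  have hcm : Real.exp (-(b * (Q 1 - P 1))) * Real.exp (b * (Q 1 - P 1)) = 1 := by
    rw [← Real.exp_add]; simp
  refine ⟨affineEquiv 0 ![Q 0 - Real.exp (-(b * (Q 1 - P 1))) * P 0, Q 1 - P 1, Q 2 - P 2,
    Q 3 - Real.exp (b * (Q 1 - P 1)) * P 3] hcm (one_mul 1) (one_mul 1),
    isIsometry_affineEquiv _ _ _ _ _ fun y => ?_, ?_⟩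
  · simp only [mul_zero, one_mul, zero_add, mul_one, Matrix.cons_val]
    rw [mul_assoc, ← Real.exp_add]
    ring_nf
  · ext l
    fin_cases l <;> simp [affineEquiv, affineLinear]

end AffineIsometries

/-! ### Constant α forces an exponential profile, which is then normalised. -/

section Exponential

variable {φ : ℝ → ℝ} (hφ : ContDiff ℝ ∞ φ)

include hφ in
theorem exists_exp_of_alpha_const (hφ2 : ∀ y, deriv (deriv φ) y ≠ 0)
    (hα : ∀ y, alpha φ y = alpha φ 0) :
    ∃ a c B : ℝ, a ≠ 0 ∧ c ≠ 0 ∧ ∀ y, φ y = a * Real.exp (c * y) + B := by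
  have hd : ∀ y, HasDerivAt φ (deriv φ y) y := hasDerivAt_self hφ
  have hφ' : ContDiff ℝ ∞ (deriv φ) := (contDiff_infty_iff_deriv.1 hφ).2
  have hd1 : ∀ y, HasDerivAt (deriv φ) (deriv (deriv φ) y) y := hasDerivAt_deriv hφ
  have hd2 : ∀ y, HasDerivAt (deriv (deriv φ)) (deriv (deriv (deriv φ)) y) y :=
    hasDerivAt_deriv hφ'
  -- If the constant were 0, φ' would vanish identically, and φ'' with it.
  have h0 : alpha φ 0 ≠ 0 := by
    intro h
    have hz : deriv φ = fun _ => 0 := by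
      funext y
      have := hα y
      rw [h, alpha, div_eq_zero_iff] at this
      simpa [hφ2 y] using this
    apply hφ2 0
    rw [hz]
    simp
  have h1 : ∀ y, deriv φ y ≠ 0 := by
    intro y h
    apply h0
    rw [← hα y, alpha, h]
    simp
  obtain ⟨c, hc⟩ : ∃ c, ∀ y, deriv (deriv φ) y = c * deriv φ y := by
    have hr : ∀ y, HasDerivAt (fun y => deriv (deriv φ) y / deriv φ y)
        ((deriv (deriv (deriv φ)) y * deriv φ y - deriv (deriv φ) y * deriv (deriv φ) y)
          / deriv φ y ^ 2) y := fun y => (hd2 y).div (hd1 y) (h1 y)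
    have hsq : (fun y => (deriv (deriv φ) y / deriv φ y) ^ 2) = fun _ => (alpha φ 0)⁻¹ := by
      funext y
      rw [← hα y, alpha, inv_div, div_pow]
    -- The ratio r = φ''/φ' has constant square, so 2rr' = 0 with r ≠ 0; r is constant with no case
    -- split on its sign.
    have hz : ∀ y, deriv (fun y => deriv (deriv φ) y / deriv φ y) y = 0 := by
      intro y
      have h3 := (hr y).pow 2
      have h4 : HasDerivAt (fun y => (deriv (deriv φ) y / deriv φ y) ^ 2) 0 y := by
        rw [hsq]
        exact hasDerivAt_const y _
      have h5 := h3.unique h4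
      rw [(hr y).deriv]
      simpa [hφ2 y, h1 y] using h5
    refine ⟨deriv (deriv φ) 0 / deriv φ 0, fun y => ?_⟩
    rw [← is_const_of_deriv_eq_zero (fun y => (hr y).differentiableAt) hz y 0,
      div_mul_cancel₀ _ (h1 y)]
  have hc0 : c ≠ 0 := by
    rintro rfl
    exact hφ2 0 (by simp [hc])
  have he : ∀ y, HasDerivAt (fun y => Real.exp (c * y)) (Real.exp (c * y) * c) y := fun y => by
    simpa using ((hasDerivAt_id y).const_mul c).exp
  have hq : ∀ y, HasDerivAt (fun y => deriv φ y / Real.exp (c * y)) 0 y := fun y => by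
    refine ((hd1 y).div (he y) (Real.exp_ne_zero _)).congr_deriv ?_
    rw [hc]
    ring
  have hA : ∀ y, deriv φ y = deriv φ 0 * Real.exp (c * y) := by
    intro y
    have := is_const_of_deriv_eq_zero (fun y => (hq y).differentiableAt) (fun y => (hq y).deriv) y 0
    simp only [mul_zero, Real.exp_zero, div_one] at this
    rw [← this, div_mul_cancel₀ _ (Real.exp_ne_zero _)]
  have hB : ∀ y, HasDerivAt (fun y => φ y - deriv φ 0 / c * Real.exp (c * y)) 0 y := fun y => by
    refine ((hd y).sub ((he y).const_mul (deriv φ 0 / c))).congr_deriv ?_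
    rw [hA y]
    field_simp
    ring
  refine ⟨deriv φ 0 / c, c, φ 0 - deriv φ 0 / c, div_ne_zero (h1 0) hc0, hc0, fun y => ?_⟩
  have := is_const_of_deriv_eq_zero (fun y => (hB y).differentiableAt) (fun y => (hB y).deriv) y 0
  simp only [mul_zero, Real.exp_zero, mul_one] at this
  linarith

theorem exists_sign_mul_abs {a : ℝ} (ha : a ≠ 0) : ∃ e : ℝ, e * e = 1 ∧ a = e * |a| := by
  rcases lt_or_gt_of_ne ha with h | h
  · exact ⟨-1, by norm_num, by rw [abs_of_neg h]; ring⟩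
  · exact ⟨1, by norm_num, by rw [abs_of_pos h]; ring⟩

theorem exists_isometric_expMetric {a c B : ℝ} (ha : a ≠ 0) (hc : c ≠ 0)
    (h : ∀ y, φ y = a * Real.exp (c * y) + B) :
    ∃ b : ℝ, 0 < b ∧ Isometric (phiMetric φ hφ) (expMetric b) := by
  obtain ⟨e₁, h₁, hc'⟩ := exists_sign_mul_abs hc
  obtain ⟨e₂, h₂, ha'⟩ := exists_sign_mul_abs ha
  have hb := abs_pos.2 hc
  -- Reflecting y fixes the sign of c, translating y absorbs |a|, reflecting z fixes the sign of a,
  -- and adding 2Bz to x̄ absorbs B.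
  refine ⟨|c|, hb, affineEquiv (c := 1) (m := 1) (2 * B) ![0, Real.log |a| / |c|, 0, 0]
    (one_mul 1) h₁ h₂, isIsometry_affineEquiv _ _ _ _ _ fun y => ?_⟩
  have hexp : Real.exp (|c| * (e₁ * y + Real.log |a| / |c|)) = Real.exp (c * y) * |a| := by
    rw [mul_add, mul_div_cancel₀ _ hb.ne', Real.exp_add, Real.exp_log (abs_pos.2 ha)]
    congr 2
    rw [← mul_assoc, mul_comm |c|, ← hc']
  simp only [Matrix.cons_val]
  rw [hexp, h]
  linear_combination (-2 * Real.exp (c * y)) * ha'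

end Exponential

end PseudoRiem

theorem theorem1p3 (φ : ℝ → ℝ) (hφ : ContDiff ℝ ∞ φ) (hφ2 : ∀ y, deriv (deriv φ) y ≠ 0) :
    (∀ p : Fin 4 → ℝ,
      Module.finrank ℝ (LinearMap.range ((PseudoRiem.phiMetric φ hφ).ricci p)) = 2 ∧
      Module.finrank ℝ (LinearMap.range ((PseudoRiem.phiMetric φ hφ).ricci p ^ 2)) = 1 ∧
      (PseudoRiem.phiMetric φ hφ).ricci p ^ 3 = 0) ∧
    ¬ (PseudoRiem.phiMetric φ hφ).IsJacobiVidev ∧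
    (∀ (ψ : ℝ → ℝ) (hψ : ContDiff ℝ ∞ ψ), (∀ y, deriv (deriv ψ) y ≠ 0) →
      ∀ (U : Set (Fin 4 → ℝ)) (Φ : (Fin 4 → ℝ) → (Fin 4 → ℝ)),
        PseudoRiem.IsLocalIsometryOn (PseudoRiem.phiMetric φ hφ) (PseudoRiem.phiMetric ψ hψ) U Φ →
        ∀ p ∈ U, PseudoRiem.alpha ψ (Φ p 1) = PseudoRiem.alpha φ (p 1)) ∧
    List.TFAE [(PseudoRiem.phiMetric φ hφ).IsCurvatureHomogeneous,
      ∃ b : ℝ, 0 < b ∧ PseudoRiem.Isometric (PseudoRiem.phiMetric φ hφ) (PseudoRiem.expMetric b),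
      (PseudoRiem.phiMetric φ hφ).IsHomogeneous] := by
  refine ⟨fun p => ⟨PseudoRiem.finrank_range_ricci_phi hφ (hφ2 _),
    PseudoRiem.finrank_range_ricci_sq_phi hφ (hφ2 _), PseudoRiem.ricci_cube_phi hφ p⟩,
    PseudoRiem.not_isJacobiVidev_phi hφ (hφ2 0), fun ψ hψ _ U Φ hΦ p hp => ?_, ?_⟩
  · obtain ⟨L, hL⟩ := hΦ.isModelIso hp
    exact hL.alpha_eq (hφ2 _)
  tfae_have 1 → 2 := by
    intro h
    obtain ⟨a, c, B, ha, hc, hy⟩ := PseudoRiem.exists_exp_of_alpha_const hφ hφ2 fun y => by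
      obtain ⟨L, hL, hL'⟩ := h 0 (fun _ => y)
      exact PseudoRiem.IsModelIso.alpha_eq ⟨hL, hL'⟩ (hφ2 _)
    exact PseudoRiem.exists_isometric_expMetric hφ ha hc hy
  tfae_have 2 → 3 := by
    rintro ⟨b, -, Φ, hΦ⟩ P Q
    obtain ⟨Ψ, hΨ, hPQ⟩ := PseudoRiem.isHomogeneous_expMetric b (Φ P) (Φ Q)
    exact ⟨(Φ.trans Ψ).trans Φ.symm, (hΦ.trans hΨ).trans hΦ.symm, by simp [hPQ]⟩
  tfae_have 3 → 1 := by
    intro h P Q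
    obtain ⟨Φ, hΦ, rfl⟩ := h P Q
    obtain ⟨L, hL⟩ := hΦ.isModelIso P
    exact ⟨L, hL.inner, hL.curvTensor⟩
  tfae_finish
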